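/- Let $f(x) = \exp(\arctan x) \in \mathbb{Q}[[x]]$ be the composition of the formal power series $\exp(x) = \sum_{n \ge 0} \frac{x^n}{n!}$ and $\arctan(x) = \sum_{n \ge 0} \frac{(-1)^n}{2n+1} x^{2n+1}$. For a prime $p$, let $\mathbb{Z}_{(p)} \subseteq \mathbb{Q}$ be the ring of rational numbers whose denominator in lowest terms is not divisible by $p$. Then for every prime $p \equiv 1 \pmod 4$, the series $f(x)$ belongs to $\mathbb{Z}_{(p)}[[x]]$, and the series $f(x) \bmod p \in \mathbb{F}_p[[x]]$ obtained by reducing its coefficients modulo $p$, regarded as an element of the field of formal Laurent series $\mathbb{F}_p((x))$, is transcendental over the field of rational functions $\mathbb{F}_p(x)$. -/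

import Mathlib

open scoped RatFunc

/-- The Taylor series of `arctan` at `0`, over `ℚ`:
`arctan x = x - x ^ 3 / 3 + x ^ 5 / 5 - ⋯`. -/
noncomputable def arctanSeries : PowerSeries ℚ :=
  PowerSeries.mk fun n => if Odd n then (-1 : ℚ) ^ (n / 2) / (n : ℚ) else 0

/-- The series `arctan x` has no constant term, so it may be substituted into any power series. -/
theorem hasSubst_arctanSeries : PowerSeries.HasSubst arctanSeries :=
  PowerSeries.HasSubst.of_constantCoeff_zero' (by
    rw [← PowerSeries.coeff_zero_eq_constantCoeff_apply]
    simp [arctanSeries])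

/-- The series `exp (arctan x)` in `ℚ⟦x⟧`: the composition of the exponential series with the
series `arctan x`. -/
noncomputable def expArctanSeries : PowerSeries ℚ :=
  (PowerSeries.exp ℚ).subst arctanSeries

/-- The series `f` lies in `ℤ_(p)⟦x⟧`: no coefficient, written in lowest terms, has a denominator
divisible by `p`. -/
def IsIntegralAt (p : ℕ) (f : PowerSeries ℚ) : Prop :=
  ∀ n : ℕ, ¬ p ∣ (PowerSeries.coeff n f).den

/-- The reduction `f mod p` in `𝔽_p⟦x⟧`, coefficient by coefficient: a coefficient `a / b` in
lowest terms is sent to `(a mod p) / (b mod p)`. It is meaningful for `f` in `ℤ_(p)⟦x⟧`, where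
every `b mod p` is nonzero. -/
noncomputable def reductionMod (p : ℕ) [Fact p.Prime] (f : PowerSeries ℚ) :
    PowerSeries (ZMod p) :=
  PowerSeries.mk fun n =>
    ((PowerSeries.coeff n f).num : ZMod p) / ((PowerSeries.coeff n f).den : ZMod p)

/-! Since `p ≡ 1 mod 4`, `ℤ_p` contains `i` with `i ^ 2 = -1`. Put `w = (1 + i X) / (1 - i X)` and
`a = 1 / (2 i)`. Then `exp (arctan X) = w ^ a`, as both solve `(1 + X ^ 2) f' = f` with constant
term `1` (`map_expArctanSeries`); binomial series over `ℤ_p` make `w ^ a` integral.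

Modulo `p`, the powers `w ^ b` with `b ∈ ℤ_p` are linearly independent over `𝔽_p`
(`linearIndependent_of_padicInt_hom`). As `X` is a Möbius function of `w`, clearing denominators
turns an algebraic relation for `w ^ a` into a linear one among the `w ^ (n + k a)`. These exponents
are distinct because `a` is irrational, so the relation is trivial. -/

/-! ### Binomial series and the differential equation -/

theorem PowerSeries.constantCoeff_map {R S : Type*} [CommRing R] [CommRing S] (φ : R →+* S)
    (f : PowerSeries R) : constantCoeff (map φ f) = φ (constantCoeff f) := by
  rw [← coeff_zero_eq_constantCoeff_apply, coeff_map, coeff_zero_eq_constantCoeff_apply]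

open PowerSeries in
theorem PowerSeries.derivative_rescale {R : Type*} [CommRing R] (c : R) (f : PowerSeries R) :
    derivative R (rescale c f) = C c * rescale c (derivative R f) := by
  ext n
  simp only [coeff_derivative, coeff_rescale, coeff_C_mul]
  ring

/-- The Pascal-type identity `(n + 1) * (r choose n + 1) = (r - n) * (r choose n)`. -/
theorem Ring.succ_mul_choose_succ {R : Type*} [CommRing R] [BinomialRing R] (r : R) (n : ℕ) :
    ((n : R) + 1) * Ring.choose r (n + 1) = (r - n) * Ring.choose r n := by
  have h := Ring.choose_smul_choose r (Nat.le_succ n)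
  simp [nsmul_eq_mul] at h
  linear_combination h

open PowerSeries in
theorem PowerSeries.derivative_binomialSeries {R : Type*} [CommRing R] [BinomialRing R] (r : R) :
    (1 + X) * derivative R (binomialSeries R r) = C r * binomialSeries R r := by
  ext n
  rw [add_mul, one_mul, map_add, coeff_C_mul]
  cases n with
  | zero =>
    simp [coeff_derivative]
  | succ n =>
    rw [coeff_succ_X_mul]
    simp only [coeff_derivative, binomialSeries_coeff, smul_eq_mul, mul_one]
    have h := Ring.succ_mul_choose_succ r (n + 1)
    push_cast at h ⊢
    linear_combination h

open PowerSeries in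
theorem PowerSeries.eq_of_one_add_X_sq_mul_derivative {R : Type*} [CommRing R] [IsDomain R]
    [CharZero R] {f g : PowerSeries R} (hf : (1 + X ^ 2) * derivative R f = f)
    (hg : (1 + X ^ 2) * derivative R g = g) (h0 : constantCoeff f = constantCoeff g) : f = g := by
  suffices ∀ h : PowerSeries R, (1 + X ^ 2) * derivative R h = h → constantCoeff h = 0 → h = 0 by
    refine sub_eq_zero.1 (this (f - g) ?_ (by simp [h0]))
    rw [map_sub, mul_sub, hf, hg]
  intro h hh h0
  ext n
  induction n using Nat.strong_induction_on with
  | _ n ih =>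
    cases n with
    | zero => simpa using h0
    | succ n =>
      have hn := congrArg (coeff n) hh
      rw [add_mul, one_mul, map_add, coeff_X_pow_mul', ih n n.lt_succ_self,
        coeff_derivative] at hn
      have hz : (if 2 ≤ n then coeff (n - 2) (derivative R h) else 0) = 0 := by
        split_ifs with h2
        · rw [coeff_derivative, ih _ (by lia)]
          simp
        · rfl
      rw [hz] at hn
      have hne : (n : R) + 1 ≠ 0 := Nat.cast_add_one_ne_zero n
      simpa [hne] using hn

open PowerSeries in
theorem one_add_X_sq_mul_derivative_arctanSeries :
    (1 + X ^ 2) * derivative ℚ arctanSeries = 1 := by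
  ext n
  rw [add_mul, one_mul, map_add, coeff_X_pow_mul', coeff_one]
  simp only [coeff_derivative, arctanSeries, coeff_mk]
  rcases n with _ | _ | n
  · simp
  · simp
  · have h1 : (n : ℚ) + 1 ≠ 0 := Nat.cast_add_one_ne_zero n
    have h2 : (n : ℚ) + 1 + 1 + 1 ≠ 0 := by positivity
    rcases Nat.even_or_odd n with he | ho
    · have o1 : Odd (n + 1) := he.add_one
      have o2 : Odd (n + 1 + 1 + 1) := o1.add_one.add_one
      have e1 : (n + 1 + 1 + 1) / 2 = (n + 1) / 2 + 1 := by lia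
      simp [o1, o2, e1]
      field_simp
      ring
    · have o1 : ¬ Odd (n + 1) := by simpa using ho.add_one
      have o2 : ¬ Odd (n + 1 + 1 + 1) := by simpa using ho.add_one.add_one.add_one
      simp [o1, o2]

open PowerSeries in
theorem one_add_X_sq_mul_derivative_expArctanSeries :
    (1 + X ^ 2) * derivative ℚ expArctanSeries = expArctanSeries := by
  rw [expArctanSeries, derivative_subst hasSubst_arctanSeries, derivative_exp]
  linear_combination ((PowerSeries.exp ℚ).subst arctanSeries) *
    one_add_X_sq_mul_derivative_arctanSeries

open PowerSeries in
theorem constantCoeff_expArctanSeries : constantCoeff expArctanSeries = 1 := by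
  have h0 : constantCoeff arctanSeries = 0 := by
    rw [← coeff_zero_eq_constantCoeff_apply]
    simp [arctanSeries]
  rw [← coeff_zero_eq_constantCoeff_apply, expArctanSeries, coeff_subst' hasSubst_arctanSeries,
    finsum_eq_single _ 0]
  · simp
  · intro n hn
    simp [h0, hn]

/-! ### `p`-adic powers of the Cayley transform -/

open PowerSeries in
/-- The homomorphism `b ↦ ((1 + i X) / (1 - i X)) ^ b` from `ℤ_p` to power series over `ℤ_p`. -/
noncomputable def cayleyPow (p : ℕ) [Fact p.Prime] (i : ℤ_[p]) :
    Multiplicative ℤ_[p] →* PowerSeries ℤ_[p] where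
  toFun b := rescale i (binomialSeries ℤ_[p] b.toAdd) *
    rescale (-i) (binomialSeries ℤ_[p] (-b.toAdd))
  map_one' := by simp
  map_mul' b c := by
    rw [toAdd_mul, neg_add, binomialSeries_add, binomialSeries_add, map_mul, map_mul]
    ring

section CayleyPow

open PowerSeries Multiplicative

variable {p : ℕ} [Fact p.Prime]

theorem cayleyPow_apply (i b : ℤ_[p]) : cayleyPow p i (ofAdd b) =
    rescale i (binomialSeries ℤ_[p] b) * rescale (-i) (binomialSeries ℤ_[p] (-b)) := rfl

theorem constantCoeff_cayleyPow (i : ℤ_[p]) (b : Multiplicative ℤ_[p]) :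
    constantCoeff (cayleyPow p i b) = 1 := by
  have h : ∀ (c : ℤ_[p]) (f : PowerSeries ℤ_[p]), constantCoeff (rescale c f) = constantCoeff f := by
    intro c f
    rw [← coeff_zero_eq_constantCoeff_apply, coeff_rescale]
    simp
  rw [← ofAdd_toAdd b, cayleyPow_apply, map_mul, h, h]
  simp

theorem cayleyPow_one_mul (i : ℤ_[p]) :
    cayleyPow p i (ofAdd 1) * (1 - C i * X) = 1 + C i * X := by
  have h1 : binomialSeries ℤ_[p] (1 : ℤ_[p]) = 1 + X := by
    simpa using binomialSeries_nat (R := ℤ_[p]) (A := ℤ_[p]) 1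
  have h2 : rescale (-i) (binomialSeries ℤ_[p] (-1 : ℤ_[p])) * (1 - C i * X) = 1 := by
    have h3 : (1 - C i * X : PowerSeries ℤ_[p]) = rescale (-i) (binomialSeries ℤ_[p] (1 : ℤ_[p])) := by
      rw [h1]
      simp [rescale_X, sub_eq_add_neg]
    rw [h3, ← map_mul, ← binomialSeries_add]
    simp
  rw [cayleyPow_apply, mul_assoc, h2, h1]
  simp [rescale_X]

/-- The logarithmic derivative of `w ^ a` is `2 i a / (1 + X ^ 2)`, because `(1 + i X) (1 - i X) = 1
+ X ^ 2`. -/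
theorem one_add_X_sq_mul_derivative_cayleyPow {i a : ℤ_[p]} (hi : i ^ 2 = -1)
    (ha : 2 * (i * a) = 1) :
    (1 + X ^ 2) * derivative ℤ_[p] (cayleyPow p i (ofAdd a)) = cayleyPow p i (ofAdd a) := by
  have hC : ∀ c r : ℤ_[p], rescale c (C r) = C r := by
    intro c r
    ext n
    rw [coeff_rescale, coeff_C]
    split_ifs with h <;> simp [h]
  have key : ∀ c r : ℤ_[p], (1 + C c * X) * derivative ℤ_[p] (rescale c (binomialSeries ℤ_[p] r)) =
      C (c * r) * rescale c (binomialSeries ℤ_[p] r) := by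
    intro c r
    have h := congrArg (rescale c) (derivative_binomialSeries r)
    simp only [map_mul, map_add, map_one, rescale_X, hC] at h
    rw [derivative_rescale, map_mul]
    linear_combination C c * h
  have k1 := key i a
  have k2 := key (-i) (-a)
  rw [neg_mul_neg] at k2
  simp only [map_neg] at k2
  have hi' : (C i : PowerSeries ℤ_[p]) ^ 2 = -1 := by rw [← map_pow, hi]; simp
  have ha' : (2 : PowerSeries ℤ_[p]) * C (i * a) = 1 := by
    rw [← map_ofNat (C (R := ℤ_[p])) 2, ← map_mul, ha, map_one]
  rw [cayleyPow_apply, Derivation.leibniz, smul_eq_mul, smul_eq_mul]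
  set P := rescale i (binomialSeries ℤ_[p] a)
  set Q := rescale (-i) (binomialSeries ℤ_[p] (-a))
  linear_combination (1 + C i * X) * P * k2 + (1 - C i * X) * Q * k1 + P * Q * ha' +
    X ^ 2 * (P * derivative _ Q + Q * derivative _ P) * hi'

theorem map_expArctanSeries {i a : ℤ_[p]} (hi : i ^ 2 = -1) (ha : 2 * (i * a) = 1) :
    map (algebraMap ℚ ℚ_[p]) expArctanSeries =
      map (algebraMap ℤ_[p] ℚ_[p]) (cayleyPow p i (ofAdd a)) := by
  have hd : ∀ {R S : Type} [CommRing R] [CommRing S] (φ : R →+* S) {f : PowerSeries R},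
      (1 + X ^ 2) * derivative R f = f → (1 + X ^ 2) * derivative S (map φ f) = map φ f := by
    intro R S _ _ φ f hf
    have hm : derivative S (map φ f) = map φ (derivative R f) := by
      ext n
      simp [coeff_derivative]
    conv_rhs => rw [← hf]
    simp [hm]
  refine eq_of_one_add_X_sq_mul_derivative
    (hd _ one_add_X_sq_mul_derivative_expArctanSeries)
    (hd _ (one_add_X_sq_mul_derivative_cayleyPow hi ha)) ?_
  rw [PowerSeries.constantCoeff_map, PowerSeries.constantCoeff_map, constantCoeff_expArctanSeries,
    constantCoeff_cayleyPow, map_one, map_one]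

/-- A rational number that is a `p`-adic integer has denominator prime to `p`, and its two
reductions modulo `p` agree. -/
theorem Rat.den_not_dvd_and_num_div_den_eq_toZMod {q : ℚ} {z : ℤ_[p]}
    (h : (q : ℚ_[p]) = (z : ℚ_[p])) :
    ¬ p ∣ q.den ∧ (q.num : ZMod p) / (q.den : ZMod p) = PadicInt.toZMod z := by
  have h1 : (q.den : ℤ_[p]) * z = q.num := by
    apply PadicInt.ext
    push_cast
    rw [← h]
    exact_mod_cast Rat.den_mul_eq_num q
  have h2 := congrArg PadicInt.toZMod h1
  simp only [map_mul, map_natCast, map_intCast] at h2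
  have h3 : ¬ p ∣ q.den := by
    intro hd
    rw [(ZMod.natCast_eq_zero_iff _ _).2 hd, zero_mul] at h2
    have hn : p ∣ q.num.natAbs := by
      rw [← Int.natCast_dvd]
      exact (ZMod.intCast_zmod_eq_zero_iff_dvd _ _).1 h2.symm
    exact (Fact.out : p.Prime).one_lt.ne' (Nat.dvd_one.1 (q.reduced ▸ Nat.dvd_gcd hn hd))
  refine ⟨h3, ?_⟩
  rw [div_eq_iff (by rwa [Ne, ZMod.natCast_eq_zero_iff]), ← h2, mul_comm]

end CayleyPow

/-! ### Linear independence of `p`-adic powers in characteristic `p` -/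

section Independence

open PowerSeries Multiplicative

variable {p : ℕ} [Fact p.Prime] {K : Type*} [Field K]

/-- As `X * v` has order exactly one, the `X`-order of `P (1 + X v)` is the multiplicity of `1` as a
root of `P`, which is at most the degree. -/
theorem eq_zero_of_X_pow_dvd_aeval {P : Polynomial K} {n : ℕ} (hP : P.degree < n)
    {v : PowerSeries K} (hv : constantCoeff v ≠ 0)
    (hdvd : (PowerSeries.X : PowerSeries K) ^ n ∣ Polynomial.aeval (1 + PowerSeries.X * v) P) :
    P = 0 := by
  by_contra h0
  obtain ⟨Q, hQ, hndvd⟩ := Polynomial.exists_eq_pow_rootMultiplicity_mul_and_not_dvd P h0 1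
  set m := P.rootMultiplicity 1
  have hm : m < n := by
    have h1 : m ≤ P.natDegree := by
      have := Polynomial.natDegree_le_of_dvd (Polynomial.pow_rootMultiplicity_dvd P 1) h0
      rwa [Polynomial.natDegree_pow, Polynomial.natDegree_X_sub_C, mul_one] at this
    have h2 := (Polynomial.natDegree_lt_iff_degree_lt h0).2 hP
    lia
  have hQ1 : constantCoeff (v ^ m * Polynomial.aeval (1 + PowerSeries.X * v) Q) ≠ 0 := by
    have h1 : constantCoeff (Polynomial.aeval (1 + PowerSeries.X * v) Q) = Q.eval 1 := by
      rw [Polynomial.aeval_def, Polynomial.hom_eval₂]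
      simp [Polynomial.eval₂_eq_eval_map]
    rw [map_mul, map_pow, h1]
    refine mul_ne_zero (pow_ne_zero _ hv) fun h => hndvd (Polynomial.dvd_iff_isRoot.2 h)
  apply hQ1
  rw [← X_dvd_iff]
  have h2 : (PowerSeries.X : PowerSeries K) ^ m * PowerSeries.X ∣ PowerSeries.X ^ m *
      (v ^ m * Polynomial.aeval (1 + PowerSeries.X * v) Q) := by
    rw [← pow_succ]
    refine (pow_dvd_pow _ (Nat.succ_le_of_lt hm)).trans (hdvd.trans (dvd_of_eq ?_))
    conv_lhs => rw [hQ]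
    simp [mul_pow, mul_assoc]
  exact (mul_dvd_mul_iff_left (pow_ne_zero _ X_ne_zero)).1 h2

theorem exists_injOn_appr (s : Finset ℤ_[p]) :
    ∃ k, Set.InjOn (fun b : ℤ_[p] => b.appr k) s := by
  -- One more than every valuation of a difference, so distinct elements of `s` stay distinct modulo
  -- `p ^ k`.
  obtain ⟨k, hk⟩ : ∃ k, k = (s ×ˢ s).sup (fun x => (x.1 - x.2).valuation) + 1 := ⟨_, rfl⟩
  refine ⟨k, fun b hb c hc (hbc : b.appr k = c.appr k) => ?_⟩
  by_contra hne
  have h1 : b - c ∈ Ideal.span {(p : ℤ_[p]) ^ k} := by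
    have := Ideal.sub_mem _ (PadicInt.appr_spec k b) (PadicInt.appr_spec k c)
    rwa [hbc, sub_sub_sub_cancel_right] at this
  rw [PadicInt.mem_span_pow_iff_le_valuation _ (sub_ne_zero.2 hne)] at h1
  have h2 := Finset.le_sup (f := fun x : ℤ_[p] × ℤ_[p] => (x.1 - x.2).valuation)
    (Finset.mk_mem_product hb hc)
  simp only at h2
  lia

/-- A homomorphism from `ℤ_p` to principal units of `K⟦X⟧`, where `K` has characteristic `p`, is
determined modulo `X ^ (p ^ k)` by the exponents modulo `p ^ k`. -/
theorem X_pow_dvd_sub_pow_appr [CharP K p] (χ : Multiplicative ℤ_[p] →* PowerSeries K)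
    (h1 : ∀ b, constantCoeff (χ b) = 1) (b : ℤ_[p]) (k : ℕ) :
    X ^ p ^ k ∣ χ (ofAdd b) - χ (ofAdd 1) ^ b.appr k := by
  obtain ⟨c, hc⟩ := Ideal.mem_span_singleton'.1 (PadicInt.appr_spec k b)
  have hb : ofAdd b = ofAdd 1 ^ b.appr k * ofAdd c ^ p ^ k := by
    rw [← ofAdd_nsmul, ← ofAdd_nsmul, ← ofAdd_add]
    congr 1
    simp only [nsmul_eq_mul]
    push_cast
    linear_combination -hc
  have : CharP (PowerSeries K) p := charP_of_injective_ringHom C_injective p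
  -- Frobenius turns divisibility by `X` into divisibility by `X ^ p ^ k`.
  have h2 : χ (ofAdd c) ^ p ^ k - 1 = (χ (ofAdd c) - 1) ^ p ^ k := by
    rw [sub_pow_char_pow, one_pow]
  have h3 : X ∣ χ (ofAdd c) - 1 := by
    rw [X_dvd_iff]
    simp [h1]
  rw [hb, map_mul, map_pow, map_pow, ← mul_sub_one, h2]
  exact (pow_dvd_pow_of_dvd h3 _).mul_left _

/-- Modulo `X ^ p ^ k`, a relation becomes a polynomial of degree below `p ^ k` in `χ (ofAdd 1)`,
hence the zero polynomial; for large `k` its monomials are distinct. -/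
theorem linearIndependent_of_padicInt_hom [CharP K p]
    (χ : Multiplicative ℤ_[p] →* PowerSeries K) (h1 : ∀ b, constantCoeff (χ b) = 1)
    {v : PowerSeries K} (hv : constantCoeff v ≠ 0) (hχ : χ (ofAdd 1) = 1 + X * v) :
    LinearIndependent K fun b : ℤ_[p] => χ (ofAdd b) := by
  rw [linearIndependent_iff']
  intro s g hg b hb
  obtain ⟨k, hk⟩ := exists_injOn_appr s
  set P : Polynomial K := ∑ b ∈ s, Polynomial.C (g b) * Polynomial.X ^ b.appr k with hPdef
  have hP : P = 0 := by
    apply eq_zero_of_X_pow_dvd_aeval (n := p ^ k) _ hv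
    · have h2 : Polynomial.aeval (1 + X * v) P =
          -∑ b ∈ s, g b • (χ (ofAdd b) - χ (ofAdd 1) ^ b.appr k) := by
        simp only [smul_sub, Finset.sum_sub_distrib, hg, hPdef, map_sum, map_mul, map_pow,
          Polynomial.aeval_X, Polynomial.aeval_C, hχ, zero_sub, neg_neg]
        simp only [Algebra.smul_def]
      rw [h2, dvd_neg]
      refine Finset.dvd_sum fun b _ => ?_
      exact dvd_smul_of_dvd _ (X_pow_dvd_sub_pow_appr χ h1 b k)
    · refine (Polynomial.degree_sum_le _ _).trans_lt ?_
      rw [Finset.sup_lt_iff (WithBot.bot_lt_coe _)]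
      intro b _
      refine (Polynomial.degree_C_mul_X_pow_le _ _).trans_lt ?_
      exact_mod_cast PadicInt.appr_lt b k
  have h3 := congrArg (Polynomial.coeff · (b.appr k)) hP
  simp only [hPdef, Polynomial.finsetSum_coeff, Polynomial.coeff_C_mul_X_pow,
    Polynomial.coeff_zero] at h3
  rw [Finset.sum_eq_single_of_mem b hb] at h3
  · simpa using h3
  · intro c hc hcb
    rw [if_neg fun h => hcb (hk hc hb h.symm)]

/-- Homogenization along the Cayley transform `w = (1 + j X) / (1 - j X)`: a polynomial in `X` of
degree at most `N` is `(1 - j X) ^ N` times a polynomial in `w`. -/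
theorem exists_aeval_mul_pow_eq_coe {j : K} (hj : j ≠ 0) (h2 : (2 : K) ≠ 0) {w : PowerSeries K}
    (hw : w * (1 - C j * X) = 1 + C j * X) {c : Polynomial K} {N : ℕ} (hN : c.natDegree ≤ N) :
    ∃ d : Polynomial K, Polynomial.aeval w d * (1 - C j * X) ^ N = (c : PowerSeries K) := by
  -- Homogenizes `c` using `X = (w - 1) / (2 j) * (1 - j X)` and `1 = (w + 1) / 2 * (1 - j X)`.
  refine ⟨∑ m ∈ Finset.range (N + 1), Polynomial.C (c.coeff m) *
    ((Polynomial.X - 1) * Polynomial.C (2 * j)⁻¹) ^ m *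
    ((Polynomial.X + 1) * Polynomial.C 2⁻¹) ^ (N - m), ?_⟩
  have e1 : (w - 1) * C (2 * j)⁻¹ * (1 - C j * X) = X := by
    have : (C (2 * j)⁻¹ : PowerSeries K) * (C 2 * C j) = 1 := by
      rw [← map_mul, ← map_mul, inv_mul_cancel₀ (mul_ne_zero h2 hj), map_one]
    rw [show (C 2 : PowerSeries K) = 2 from map_ofNat _ 2] at this
    linear_combination C (2 * j)⁻¹ * hw + X * this
  have e2 : (w + 1) * C 2⁻¹ * (1 - C j * X) = 1 := by
    have : (C 2⁻¹ : PowerSeries K) * C 2 = 1 := by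
      rw [← map_mul, inv_mul_cancel₀ h2, map_one]
    rw [show (C 2 : PowerSeries K) = 2 from map_ofNat _ 2] at this
    linear_combination C 2⁻¹ * hw + this
  conv_rhs => rw [c.as_sum_range_C_mul_X_pow' (Nat.lt_succ_of_le hN)]
  rw [map_sum, Finset.sum_mul, ← Polynomial.coeToPowerSeries.ringHom_apply, map_sum]
  refine Finset.sum_congr rfl fun m hm => ?_
  have hmN : m + (N - m) = N := by
    have := Finset.mem_range.1 hm
    lia
  have hC : ∀ r : K, algebraMap K (PowerSeries K) r = C r := fun r => rfl
  simp only [map_mul, map_pow, map_sub, map_add, map_one, Polynomial.aeval_X, Polynomial.aeval_C,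
    hC, Polynomial.coeToPowerSeries.ringHom_apply, Polynomial.coe_C, Polynomial.coe_X]
  conv_lhs => rw [← hmN, pow_add, Nat.add_sub_cancel_left]
  calc _ = C (c.coeff m) * ((w - 1) * C (2 * j)⁻¹ * (1 - C j * X)) ^ m *
        ((w + 1) * C 2⁻¹ * (1 - C j * X)) ^ (N - m) := by
        simp only [mul_pow]
        ring
    _ = _ := by rw [e1, e2, one_pow, mul_one]

theorem eq_zero_of_eval₂_padicInt_hom [CharP K p]
    (χ : Multiplicative ℤ_[p] →* PowerSeries K) (h1 : ∀ b, constantCoeff (χ b) = 1)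
    {j : K} (hj : j ≠ 0) (h2 : (2 : K) ≠ 0)
    (hw : χ (ofAdd 1) * (1 - C j * X) = 1 + C j * X) {a : ℤ_[p]}
    (ha : Function.Injective fun x : ℕ × ℕ => (x.2 : ℤ_[p]) + x.1 * a)
    {c : Polynomial (Polynomial K)}
    (hc : c.eval₂ Polynomial.coeToPowerSeries.ringHom (χ (ofAdd a)) = 0) : c = 0 := by
  set w := χ (ofAdd 1) with hwdef
  have hB : (1 - C j * X : PowerSeries K) ≠ 0 := by
    intro h
    simpa using congrArg constantCoeff h
  have hli : LinearIndependent K fun b : ℤ_[p] => χ (ofAdd b) := by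
    obtain ⟨v, hv⟩ : X ∣ w - 1 := by
      rw [X_dvd_iff]
      simp [hwdef, h1]
    have hw' : w = 1 + X * v := by rw [← hv]; ring
    refine linearIndependent_of_padicInt_hom χ h1 (v := v) ?_ hw'
    have h3 : v * (1 - C j * X) = C (2 * j) := by
      apply mul_left_cancel₀ (X_ne_zero (R := K))
      rw [map_mul, show (C 2 : PowerSeries K) = 2 from map_ofNat _ 2]
      linear_combination hw - (1 - C j * X) * hw'
    have h4 := congrArg constantCoeff h3
    simp at h4
    rw [h4]
    exact mul_ne_zero h2 hj
  have hli2 := hli.comp _ ha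
  set N := c.support.sup fun k => (c.coeff k).natDegree
  have hN : ∀ k, (c.coeff k).natDegree ≤ N := by
    intro k
    by_cases hk : k ∈ c.support
    · exact Finset.le_sup (f := fun k => (c.coeff k).natDegree) hk
    · simp [Polynomial.notMem_support_iff.1 hk]
  choose d hd using fun k => exists_aeval_mul_pow_eq_coe hj h2 hw (hN k)
  set M := c.support.sup (fun k => (d k).natDegree) + 1
  have hM : ∀ k ∈ c.support, (d k).natDegree < M := fun k hk =>
    Nat.lt_succ_of_le (Finset.le_sup (f := fun k => (d k).natDegree) hk)
  have hsum : ∑ k ∈ c.support, Polynomial.aeval w (d k) * χ (ofAdd a) ^ k = 0 := by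
    apply mul_right_cancel₀ (pow_ne_zero N hB)
    rw [zero_mul, ← hc, Polynomial.eval₂_eq_sum, Polynomial.sum, Finset.sum_mul]
    refine Finset.sum_congr rfl fun k _ => ?_
    rw [Polynomial.coeToPowerSeries.ringHom_apply, ← hd k]
    ring
  have hsum2 : ∑ x ∈ c.support ×ˢ Finset.range M, (d x.1).coeff x.2 •
      χ (ofAdd ((x.2 : ℤ_[p]) + x.1 * a)) = 0 := by
    rw [Finset.sum_product, ← hsum]
    refine Finset.sum_congr rfl fun k hk => ?_
    rw [Polynomial.aeval_eq_sum_range' (hM k hk), Finset.sum_mul]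
    refine Finset.sum_congr rfl fun n _ => ?_
    rw [smul_mul_assoc, hwdef, ← map_pow χ, ← map_pow χ, ← map_mul χ, ← ofAdd_nsmul,
      ← ofAdd_nsmul, ← ofAdd_add]
    simp
  have hzero := linearIndependent_iff'.1 hli2 _ (fun x => (d x.1).coeff x.2) hsum2
  rw [← Polynomial.support_eq_empty, Finset.eq_empty_iff_forall_notMem]
  intro k hk
  have hdk : d k = 0 := by
    ext n
    by_cases hn : n < M
    · exact hzero (k, n) (Finset.mk_mem_product hk (Finset.mem_range.2 hn))
    · exact Polynomial.coeff_eq_zero_of_natDegree_lt ((hM k hk).trans_le (not_lt.1 hn))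
  have h5 := hd k
  rw [hdk, map_zero, zero_mul] at h5
  exact Polynomial.mem_support_iff.1 hk (Polynomial.coe_eq_zero_iff.1 h5.symm)

theorem transcendental_ratFunc_of_eval₂_ne_zero {g : PowerSeries K}
    (hg : ∀ c : Polynomial (Polynomial K),
      c.eval₂ Polynomial.coeToPowerSeries.ringHom g = 0 → c = 0) :
    Transcendental (RatFunc K) (HahnSeries.ofPowerSeries ℤ K g : LaurentSeries K) := by
  rw [Transcendental, ← IsFractionRing.isAlgebraic_iff (Polynomial K) (RatFunc K)]
  rintro ⟨c, hc0, hc⟩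
  refine hc0 (hg c (HahnSeries.ofPowerSeries_injective (Γ := ℤ) ?_))
  rw [map_zero, Polynomial.hom_eval₂, ← hc, Polynomial.aeval_def]
  rfl

end Independence

/-! ### Arithmetic of `i` and `a`, and the conclusion -/

theorem PadicInt.exists_sq_eq_neg_one {p : ℕ} [Fact p.Prime] (hp : p ≡ 1 [MOD 4]) :
    ∃ i : ℤ_[p], i ^ 2 = -1 := by
  have hp4 : p % 4 = 1 := hp
  obtain ⟨y, hy⟩ := ZMod.exists_sq_eq_neg_one_iff.2 (show p % 4 ≠ 3 by lia)
  obtain ⟨x, rfl⟩ := ZMod.ringHom_surjective (PadicInt.toZMod (p := p)) y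
  have hlt : ∀ z : ℤ_[p], PadicInt.toZMod z = 0 ↔ ‖z‖ < 1 := by
    intro z
    rw [← RingHom.mem_ker, PadicInt.ker_toZMod, IsLocalRing.mem_maximalIdeal,
      PadicInt.mem_nonunits]
  have hone : ∀ z : ℤ_[p], PadicInt.toZMod z ≠ 0 → ‖z‖ = 1 := fun z hz =>
    le_antisymm z.norm_le_one (not_lt.1 (mt (hlt z).2 hz))
  have hx0 : PadicInt.toZMod x ≠ 0 := by
    intro h
    rw [h] at hy
    simp at hy
  have h2 : (2 : ZMod p) ≠ 0 := by
    have : ((2 : ℕ) : ZMod p) ≠ 0 := by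
      rw [Ne, ZMod.natCast_eq_zero_iff, Nat.prime_dvd_prime_iff_eq Fact.out Nat.prime_two]
      lia
    exact_mod_cast this
  obtain ⟨z, hz, -⟩ := hensels_lemma (p := p) (F := (Polynomial.X ^ 2 + 1 : Polynomial ℤ_[p]))
    (a := x) (by
      have e1 : ‖2 * x‖ = 1 := hone _ (by
        rw [map_mul, map_ofNat]
        exact mul_ne_zero h2 hx0)
      have e2 : ‖x ^ 2 + 1‖ < 1 := (hlt _).1 (by
        rw [map_add, map_pow, map_one, sq, ← hy, neg_add_cancel])
      simpa [Polynomial.derivative_X_pow, one_add_one_eq_two, e1] using e2)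
  refine ⟨z, ?_⟩
  simp at hz
  linear_combination hz

/-- Multiplying a coincidence by its conjugate gives `4 (n - n') ^ 2 + (k - k') ^ 2 = 0` over `ℤ`,
where positivity applies. -/
theorem PadicInt.injective_add_mul_of_sq {p : ℕ} [Fact p.Prime] {a : ℤ_[p]}
    (ha : 4 * a ^ 2 = -1) :
    Function.Injective fun x : ℕ × ℕ => (x.2 : ℤ_[p]) + x.1 * a := by
  rintro ⟨k, n⟩ ⟨k', n'⟩ h
  simp only at h
  have h1 : (4 * ((n : ℤ) - n') ^ 2 + ((k : ℤ) - k') ^ 2 : ℤ) = 0 := by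
    have : ((4 * ((n : ℤ) - n') ^ 2 + ((k : ℤ) - k') ^ 2 : ℤ) : ℤ_[p]) = 0 := by
      push_cast
      linear_combination 4 * ((n : ℤ_[p]) - n' - (k - k') * a) * h + ((k : ℤ_[p]) - k') ^ 2 * ha
    exact_mod_cast this
  have hn : ((n : ℤ) - n') = 0 := by
    have : ((n : ℤ) - n') ^ 2 = 0 := by nlinarith [sq_nonneg ((n : ℤ) - n'), sq_nonneg ((k : ℤ) - k')]
    exact pow_eq_zero_iff two_ne_zero |>.1 this
  have hk : ((k : ℤ) - k') = 0 := by
    rw [hn] at h1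
    simpa using h1
  ext <;> simp <;> lia

theorem proposition2p1p1 (p : ℕ) [Fact p.Prime] (hp : p ≡ 1 [MOD 4]) :
    IsIntegralAt p expArctanSeries ∧
      Transcendental (RatFunc (ZMod p))
        (HahnSeries.ofPowerSeries ℤ (ZMod p) (reductionMod p expArctanSeries) :
          LaurentSeries (ZMod p)) := by
  obtain ⟨i, hi⟩ := PadicInt.exists_sq_eq_neg_one hp
  have h2 : (2 : ZMod p) ≠ 0 := by
    have hp4 : p % 4 = 1 := hp
    have : ((2 : ℕ) : ZMod p) ≠ 0 := by
      rw [Ne, ZMod.natCast_eq_zero_iff, Nat.prime_dvd_prime_iff_eq Fact.out Nat.prime_two]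
      lia
    exact_mod_cast this
  obtain ⟨u, hu⟩ : ∃ u : ℤ_[p], 2 * u = 1 := by
    have : IsUnit (2 : ℤ_[p]) := by
      by_contra h
      rw [← mem_nonunits_iff, ← IsLocalRing.mem_maximalIdeal, ← PadicInt.ker_toZMod,
        RingHom.mem_ker, map_ofNat] at h
      exact h2 h
    exact this.exists_right_inv
  have ha : 2 * (i * (-(i * u))) = 1 := by linear_combination hu - 2 * u * hi
  have ha2 : 4 * (-(i * u)) ^ 2 = -1 := by
    linear_combination 4 * u ^ 2 * hi - (2 * u + 1) * hu
  set a := -(i * u)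
  have hcoeff : ∀ n, ((PowerSeries.coeff n expArctanSeries : ℚ) : ℚ_[p]) =
      (PowerSeries.coeff n (cayleyPow p i (Multiplicative.ofAdd a)) : ℤ_[p]) := by
    intro n
    simpa [PowerSeries.coeff_map] using congrArg (PowerSeries.coeff n) (map_expArctanSeries hi ha)
  have hred := fun n => Rat.den_not_dvd_and_num_div_den_eq_toZMod (hcoeff n)
  refine ⟨fun n => (hred n).1, ?_⟩
  set χ : Multiplicative ℤ_[p] →* PowerSeries (ZMod p) :=
    (PowerSeries.map PadicInt.toZMod : _ →+* _).toMonoidHom.comp (cayleyPow p i) with hχ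
  have hχa : reductionMod p expArctanSeries = χ (Multiplicative.ofAdd a) := by
    ext n
    simp [hχ, reductionMod, (hred n).2]
  rw [hχa]
  refine transcendental_ratFunc_of_eval₂_ne_zero fun c hc =>
    eq_zero_of_eval₂_padicInt_hom χ (fun b => ?_) (j := PadicInt.toZMod i) ?_ h2 ?_
      (PadicInt.injective_add_mul_of_sq ha2) hc
  · simp [hχ, PowerSeries.constantCoeff_map, constantCoeff_cayleyPow]
  · intro h
    have := congrArg PadicInt.toZMod hi
    simp [h] at this
  · simpa [hχ] using congrArg (PowerSeries.map PadicInt.toZMod) (cayleyPow_one_mul i)
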